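/- Let $G$ be a finite acyclic directed graph (parallel edges allowed) with one source $S$ and $n$ distinct sinks $R_1,\dots,R_n$ (designated vertices), and let the min-cut between $S$ and $R_i$ be $c_i$, i.e. $c_i$ is the minimum number of edges whose deletion destroys all directed paths from $S$ to $R_i$. A set of Menger's paths from $S$ to $R_i$ is a set consisting of the maximum number of pairwise edge-disjoint directed paths from $S$ to $R_i$. Paths $\beta_1,\dots,\beta_m$ merge at an edge $e$ if $e$ lies on all of them and there are two distinct edges $f\neq g$ and indices $i\ne j$ such that $f$ immediately precedes $e$ on $\beta_i$ and $g$ immediately precedes $e$ on $\beta_j$. The number of mergings among a collection of paths is the number of edges at which some of these paths merge (all mergings at the same edge are counted once). Let $M^*(G)$ be the minimum, over all choices of sets $\alpha_i$ of Menger's paths from $S$ to $R_i$ ($i=1,\dots,n$), of the number of mergings among the paths in $\alpha_1\cup\dots\cup\alpha_n$, and let $\mathcal{M}^*(c_1,\dots,c_n)$ be the supremum of $M^*(G)$ over all such $G$ with min-cuts $c_1,\dots,c_n$. **Proposition.** For every $n\ge 2$, $$\mathcal{M}^*(\underbrace{2,2,\dots,2}_{n})=\mathcal{M}^*(\underbrace{2,\dots,2}_{n-1})+1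 .$$ Hence, for every $n\ge 1$, $$\mathcal{M}^*(\underbrace{2,2,\dots,2}_{n})=n-1 .$$ -/

import Mathlib

/-- A finite directed graph; parallel edges are allowed. -/
structure FinDirGraph where
  V : Type
  E : Type
  finiteV : Finite V
  finiteE : Finite E
  src : E → V
  tgt : E → V

namespace FinDirGraph

variable (G : FinDirGraph)

/-- `G.IsPath u l v`: the list of edges `l` is a directed path from `u` to `v`.
(In an acyclic graph no such list can repeat a vertex or an edge.) -/
def IsPath : G.V → List G.E → G.V → Prop
  | u, [], v => u = v
  | u, e :: l, v => G.src e = u ∧ IsPath (G.tgt e) l v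

/-- There is no directed cycle. -/
def Acyclic : Prop := ∀ (v : G.V) (l : List G.E), G.IsPath v l v → l = []

/-- Deleting the edges in `C` destroys all directed paths from `u` to `v`. -/
def IsCut (u v : G.V) (C : Finset G.E) : Prop :=
  ∀ l : List G.E, G.IsPath u l v → ∃ e ∈ l, e ∈ C

/-- The min-cut between `u` and `v`: the minimum number of edges whose deletion destroys all
directed paths from `u` to `v` (it is `⊤` if `u = v`). -/
noncomputable def minCut (u v : G.V) : ℕ∞ :=
  ⨅ (C : Finset G.E) (_ : G.IsCut u v C), (C.card : ℕ∞)

/-- A finite set of pairwise edge-disjoint directed paths from `u` to `v`. -/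
def IsEdgeDisjointPaths (u v : G.V) (P : Finset (List G.E)) : Prop :=
  (∀ p ∈ P, G.IsPath u p v) ∧ ∀ p ∈ P, ∀ q ∈ P, p ≠ q → ∀ e ∈ p, e ∉ q

/-- A set of Menger's paths from `u` to `v`: a set consisting of the maximum number of pairwise
edge-disjoint directed paths from `u` to `v`. -/
def IsMengerPaths (u v : G.V) (P : Finset (List G.E)) : Prop :=
  G.IsEdgeDisjointPaths u v P ∧
    ∀ Q : Finset (List G.E), G.IsEdgeDisjointPaths u v Q → Q.card ≤ P.card

/-- The edge `f` comes immediately before the edge `e` on the path `p`. -/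
def ImmediatelyAhead (p : List G.E) (f e : G.E) : Prop := [f, e] <:+: p

/-- The paths in `B` merge at the edge `e`: all of them contain `e`, and on some two of them the
edges immediately before `e` exist and are distinct. -/
def MergeAt (B : Set (List G.E)) (e : G.E) : Prop :=
  (∀ β ∈ B, e ∈ β) ∧
    ∃ β ∈ B, ∃ γ ∈ B, β ≠ γ ∧
      ∃ f g : G.E, f ≠ g ∧ G.ImmediatelyAhead β f e ∧ G.ImmediatelyAhead γ g e

/-- The edges at which some of the paths in `A` merge. Mergings are counted without
multiplicities, so the number of mergings among the paths in `A` is the size of this set. -/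
def mergings (A : Set (List G.E)) : Set G.E := {e | ∃ B ⊆ A, G.MergeAt B e}

end FinDirGraph

/-- An acyclic directed graph with one source and `n` distinct sinks, where the min-cut between
the source and the `i`-th sink is `c i`. -/
structure OneSourceNetwork {n : ℕ} (c : Fin n → ℕ) where
  G : FinDirGraph
  acyclic : G.Acyclic
  source : G.V
  sink : Fin n → G.V
  sink_injective : Function.Injective sink
  minCut_eq : ∀ i, G.minCut source (sink i) = (c i : ℕ∞)

/-- `M*(G)`: the minimum number of mergings over all choices, for every sink, of a set of
Menger's paths from the source to that sink. -/
noncomputable def OneSourceNetwork.minMergings {n : ℕ} {c : Fin n → ℕ}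
    (N : OneSourceNetwork c) : ℕ∞ :=
  ⨅ (α : Fin n → Finset (List N.G.E))
    (_ : ∀ i, N.G.IsMengerPaths N.source (N.sink i) (α i)),
    (N.G.mergings (⋃ i, (α i : Set (List N.G.E)))).encard

/-- `𝓜*(c₁, …, cₙ)`: the supremum of `M*(G)` over all acyclic directed graphs `G` with one source
and `n` distinct sinks whose min-cuts from the source are `c₁, …, cₙ`. -/
noncomputable def MStar {n : ℕ} (c : Fin n → ℕ) : ℕ∞ :=
  ⨆ N : OneSourceNetwork c, N.minMergings

/-!
For `n` sinks of min-cut two, the extremal number of mergings is `n - 1`. Only the relation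
"`f` can immediately precede `e`" on the edges matters: paths are its chains, edge-disjoint paths
are disjoint chains, and a merging is an edge with two predecessors in the union of the chosen
paths.

Connectivity two is captured by a labelling of the edges (`IsLabeling`): an edge inherits the common
label of its predecessors, or is its own label if it has none or if their labels differ. The label
of an edge lies on every path to it (`IsLabeling.mem_of_sourcePath`), and two edges with different
labels are reached by disjoint paths (`IsLabeling.exists_disjoint`). So a sink has min-cut at least
two only if two of its incoming edges have different labels, and only such a pair is needed.

*Upper bound.* Start with one pair of edges of different labels for every sink, `n` pairs in all,
and treat the edges from the last to the first, deciding which predecessors to keep. If some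
predecessor of `v` can replace `v` in all pairs, keep only that one. Otherwise `v` has two
predecessors `p`, `q` of different labels, each in conflict with a partner of `v`. Keeping both makes
`v` a merging and makes it its own label, so all pairs at `v`, of which there are at least two, may
be replaced by the single pair `(p, q)`. Each merging thus uses up a pair and leaves one behind, so
there are at most `n - 1` of them (`IsLabeling.exists_isSparsification`,
`OneSourceNetwork.minMergings_le`).

*Lower bound.* In the chain network, edges `a`, `b` leave the source, and each member of a chain
`a, m₀, …, m_{t-1}` is fed by its predecessor in the chain and by `b`. Every two consecutive members
of the sequence `a, m₀, …, m_{t-1}, b` are observed by a sink, which makes `t + 1` sinks. The last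
sink has to use the whole chain and the others have to use the inputs from `b`, so all `mⱼ` are
mergings (`chainNetwork_minMergings`).
-/

/-! ### Labellings and disjoint paths -/

/-- A labelling of a relation `D`, read as "`D p x`: `p` is a predecessor of `x`". An element whose
predecessors all carry one label inherits that label; an element without predecessors, or with two
predecessors of different labels, is its own label. On a well-founded `D` the label of `x` is the
outermost element lying on every path from a source to `x`. -/
def IsLabeling {α : Type*} (D : α → α → Prop) (c : α → α) : Prop :=
  ∀ x, (c x = x ∧ ((∀ p, ¬ D p x) ∨ ∃ p q, D p x ∧ D q x ∧ c p ≠ c q)) ∨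
    ((∃ p, D p x) ∧ ∀ p, D p x → c p = c x)

/-- `SourcePath D l x`: the list `l` is a `D`-chain from an element without predecessors to `x`. -/
inductive SourcePath {α : Type*} (D : α → α → Prop) : List α → α → Prop
  | source {x : α} : (∀ p, ¬ D p x) → SourcePath D [x] x
  | step {l : List α} {p x : α} : SourcePath D l p → D p x → SourcePath D (l ++ [x]) x

theorem exists_isLabeling {α : Type*} {D : α → α → Prop} {ρ : α → ℕ}
    (hρ : ∀ p x, D p x → ρ p < ρ x) : ∃ c, IsLabeling D c := by
  classical
  have wf : WellFounded D := Subrelation.wf (fun {a b} h => hρ a b h) (measure ρ).wf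
  let F : (x : α) → ((y : α) → D y x → α) → α := fun x ih =>
    if h : ∃ p, ∃ hp : D p x, ∀ q (hq : D q x), ih q hq = ih p hp then
      ih h.choose h.choose_spec.choose else x
  have key : ∀ x, wf.fix F x = F x (fun y _ => wf.fix F y) := fun x => wf.fix_eq F x
  refine ⟨wf.fix F, fun x => ?_⟩
  by_cases h : ∃ p, ∃ _ : D p x, ∀ q (_ : D q x), wf.fix F q = wf.fix F p
  · refine Or.inr ⟨⟨h.choose, h.choose_spec.choose⟩, fun p hp => ?_⟩
    rw [key x]
    simp only [F, dif_pos h]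
    exact h.choose_spec.choose_spec p hp
  · refine Or.inl ⟨by rw [key x]; simp only [F, dif_neg h], ?_⟩
    push Not at h
    by_cases h0 : ∃ p, D p x
    · obtain ⟨p, hp⟩ := h0
      obtain ⟨q, hq, hne⟩ := h p hp
      exact Or.inr ⟨q, p, hq, hp, hne⟩
    · exact Or.inl (not_exists.mp h0)

theorem IsLabeling.rank_le {α : Type*} {D : α → α → Prop} {c : α → α} {ρ : α → ℕ}
    (hρ : ∀ p x, D p x → ρ p < ρ x) (hc : IsLabeling D c) (x : α) : ρ (c x) ≤ ρ x := by
  induction hk : ρ x using Nat.strong_induction_on generalizing x with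
  | _ k ih =>
    rcases hc x with ⟨h, -⟩ | ⟨⟨p, hp⟩, h⟩
    · rw [h, hk]
    · have := ih (ρ p) (hk ▸ hρ p x hp) p rfl
      rw [← h p hp]
      exact this.trans (hk ▸ (hρ p x hp).le)

theorem IsLabeling.eq_self {α : Type*} {D : α → α → Prop} {c : α → α} (hc : IsLabeling D c)
    {x : α} (hx : ∀ p, ¬ D p x) : c x = x := by
  rcases hc x with ⟨h, -⟩ | ⟨⟨p, hp⟩, -⟩
  · exact h
  · exact absurd hp (hx p)

theorem SourcePath.rank_le {α : Type*} {D : α → α → Prop} {ρ : α → ℕ}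
    (hρ : ∀ p x, D p x → ρ p < ρ x) {l : List α} {x : α} (h : SourcePath D l x) :
    ∀ e ∈ l, ρ e ≤ ρ x := by
  induction h with
  | source _ => simp
  | step _ hp ih =>
    intro e he
    rcases List.mem_append.mp he with he | he
    · exact (ih e he).trans (hρ _ _ hp).le
    · simp at he; rw [he]

theorem SourcePath.getLast? {α : Type*} {D : α → α → Prop} {l : List α} {x : α}
    (h : SourcePath D l x) : l.getLast? = some x := by
  cases h <;> simp

theorem SourcePath.isChain {α : Type*} {D : α → α → Prop} {l : List α} {x : α}
    (h : SourcePath D l x) : l.IsChain D := by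
  induction h with
  | source _ => simp
  | step hl hp ih =>
    rw [List.isChain_append]
    refine ⟨ih, by simp, fun y hy z hz => ?_⟩
    rw [hl.getLast?] at hy
    simp at hy hz
    subst hy hz
    exact hp

/-- The label of `x` separates `x` from the sources. -/
theorem IsLabeling.mem_of_sourcePath {α : Type*} {D : α → α → Prop} {c : α → α}
    (hc : IsLabeling D c) {l : List α} {x : α} (h : SourcePath D l x) : c x ∈ l := by
  induction h with
  | source hx => simp [hc.eq_self hx]
  | @step l p x _ hp ih =>
    rcases hc x with ⟨h, -⟩ | ⟨-, h⟩
    · simp [h]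
    · rw [← h p hp]; exact List.mem_append_left _ ih

theorem exists_sourcePath {α : Type*} {D : α → α → Prop} {ρ : α → ℕ}
    (hρ : ∀ p x, D p x → ρ p < ρ x) (x : α) : ∃ l, SourcePath D l x := by
  induction hk : ρ x using Nat.strong_induction_on generalizing x with
  | _ k ih =>
    by_cases h : ∃ p, D p x
    · obtain ⟨p, hp⟩ := h
      obtain ⟨l, hl⟩ := ih (ρ p) (hk ▸ hρ p x hp) p rfl
      exact ⟨_, hl.step hp⟩
    · exact ⟨_, .source (not_exists.mp h)⟩

/-- Elements with different labels are reached from the sources by disjoint paths. The later of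
the two has a predecessor whose label still differs from the other label, and it does not lie on
any path to the earlier one. -/
theorem IsLabeling.exists_disjoint {α : Type*} {D : α → α → Prop} {c : α → α} {ρ : α → ℕ}
    (hρ : ∀ p x, D p x → ρ p < ρ x) (hinj : Function.Injective ρ) (hc : IsLabeling D c) (x y : α)
    (hxy : c x ≠ c y) :
    ∃ l m, SourcePath D l x ∧ SourcePath D m y ∧ ∀ e ∈ l, e ∉ m := by
  induction hk : ρ x + ρ y using Nat.strong_induction_on generalizing x y with
  | _ k ih =>
    wlog hlt : ρ y < ρ x generalizing x y
    · have hne : ρ x ≠ ρ y := fun h => hxy (by rw [hinj h])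
      obtain ⟨l, m, hl, hm, hd⟩ := this y x hxy.symm (by omega) (by omega)
      exact ⟨m, l, hm, hl, fun e he he' => hd e he' he⟩
    by_cases h : ∃ p, D p x ∧ c p ≠ c y
    · obtain ⟨p, hp, hpy⟩ := h
      obtain ⟨l, m, hl, hm, hd⟩ := ih (ρ p + ρ y) (by have := hρ p x hp; omega) p y hpy rfl
      refine ⟨_, m, hl.step hp, hm, fun e he hem => ?_⟩
      rcases List.mem_append.mp he with he | he
      · exact hd e he hem
      · have := hm.rank_le hρ e hem
        simp at he; subst he; omega
    · push Not at h
      have h0 : ∀ p, ¬ D p x := by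
        rcases hc x with ⟨-, h0 | ⟨p, q, hp, hq, hpq⟩⟩ | ⟨⟨p, hp⟩, h1⟩
        · exact h0
        · exact absurd ((h p hp).trans (h q hq).symm) hpq
        · exact absurd ((h1 p hp).symm.trans (h p hp)) hxy
      obtain ⟨m, hm⟩ := exists_sourcePath hρ y
      refine ⟨_, m, .source h0, hm, fun e he hem => ?_⟩
      have := hm.rank_le hρ e hem
      simp at he; subst he; omega

/-! ### Sparsification -/

/-- The elements with two distinct predecessors. -/
def mergePoints {α : Type*} (D : α → α → Prop) : Set α := {x | ∃ p q, p ≠ q ∧ D p x ∧ D q x}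

/-- The relation `U` with the elements of `P` added as predecessors of `v`. -/
def addPreds {α : Type*} (U : α → α → Prop) (v : α) (P : Set α) (p x : α) : Prop :=
  U p x ∨ (x = v ∧ p ∈ P)

theorem addPreds_of_ne {α : Type*} {U : α → α → Prop} {v : α} {P : Set α} {p x : α} (h : x ≠ v) :
    addPreds U v P p x ↔ U p x := by simp [addPreds, h]

theorem addPreds_self {α : Type*} {U : α → α → Prop} {v : α} {P : Set α} (hv : ∀ p, ¬ U p v)
    {p : α} : addPreds U v P p v ↔ p ∈ P := by simp [addPreds, hv]

/-- Attaching an isolated element `v` to a single predecessor gives it the label of that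
predecessor. -/
theorem IsLabeling.addPreds_singleton {α : Type*} [DecidableEq α] {U : α → α → Prop} {d : α → α}
    (hd : IsLabeling U d) {v p : α} (hv : ∀ q, ¬ U q v) (hv' : ∀ x, ¬ U v x) (hp : p ≠ v) :
    IsLabeling (addPreds U v {p}) (Function.update d v (d p)) := by
  intro x
  by_cases hx : x = v
  · subst hx
    refine Or.inr ⟨⟨p, (addPreds_self hv).2 rfl⟩, fun q hq => ?_⟩
    rw [addPreds_self hv, Set.mem_singleton_iff] at hq
    simp [hq, hp]
  · have hne : ∀ q, U q x → q ≠ v := fun q hq h => hv' x (h ▸ hq)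
    simp only [addPreds_of_ne hx, Function.update_of_ne hx]
    rcases hd x with ⟨h, h0 | ⟨q, r, hq, hr, hqr⟩⟩ | ⟨h0, h1⟩
    · exact Or.inl ⟨h, Or.inl h0⟩
    · refine Or.inl ⟨h, Or.inr ⟨q, r, hq, hr, ?_⟩⟩
      rwa [Function.update_of_ne (hne q hq), Function.update_of_ne (hne r hr)]
    · refine Or.inr ⟨h0, fun q hq => ?_⟩
      rw [Function.update_of_ne (hne q hq), h1 q hq]

/-- Attaching an isolated element `v` to two predecessors with different labels leaves the
labelling unchanged. -/
theorem IsLabeling.addPreds_pair {α : Type*} {U : α → α → Prop} {d : α → α}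
    (hd : IsLabeling U d) {v p q : α} (hv : ∀ q, ¬ U q v) (hpq : d p ≠ d q) :
    IsLabeling (addPreds U v {p, q}) d := by
  intro x
  by_cases hx : x = v
  · subst hx
    exact Or.inl ⟨hd.eq_self hv, Or.inr
      ⟨p, q, (addPreds_self hv).2 (by simp), (addPreds_self hv).2 (by simp), hpq⟩⟩
  · simp only [addPreds_of_ne hx]
    exact hd x

/-- The properties required of a subrelation `U` of `D`, labelled by `d`, on the elements of rank
below `k`: it is still spanning there, it keeps the labels of the pairs in `C` apart, and it has
fewer merge points than `C` has pairs (none if `C` is empty, the subtraction being truncated). -/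
structure IsSparsification {α : Type*} (D : α → α → Prop) (ρ : α → ℕ) (k : ℕ)
    (C : Finset (α × α)) (U : α → α → Prop) (d : α → α) : Prop where
  le : ∀ p x, U p x → D p x
  rank_lt : ∀ p x, U p x → ρ x < k
  spanning : ∀ x, ρ x < k → (∃ p, D p x) → ∃ p, U p x
  labeling : IsLabeling U d
  separates : ∀ z ∈ C, d z.1 ≠ d z.2
  encard_le : (mergePoints U).encard ≤ ((C.card - 1 : ℕ) : ℕ∞)

/-- Pairs with different labels can be kept apart by a sparsification. The elements are treated by
decreasing rank. If the topmost element `v` has a predecessor whose label differs from the labels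
of all partners of `v` in `C`, it is attached to that predecessor, which takes its place in `C`.
Otherwise `v` has two predecessors `p`, `q` of different labels, each in conflict with a partner
of `v`; both are kept, and the pairs at `v`, at least two in number, are replaced by the single
pair `(p, q)`. Hence every merge point lowers the number of pairs, which stays positive. -/
theorem IsLabeling.exists_isSparsification {α : Type*} {D : α → α → Prop} {c : α → α}
    {ρ : α → ℕ} (hρ : ∀ p x, D p x → ρ p < ρ x) (hinj : Function.Injective ρ)
    (hc : IsLabeling D c) (k : ℕ) (C : Finset (α × α))
    (hC : ∀ z ∈ C, ρ z.1 < k ∧ ρ z.2 < k ∧ c z.1 ≠ c z.2) :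
    ∃ U d, IsSparsification D ρ k C U d := by
  classical
  induction k generalizing C with
  | zero =>
    refine ⟨fun _ _ => False, id, by simp, by simp, by simp, ?_, ?_, ?_⟩
    · intro x; simp
    · intro z hz; have := (hC z hz).1; omega
    · simp [mergePoints]
  | succ k ih =>
    by_cases hv : ∃ v, ρ v = k
    swap
    · have hlt : ∀ x, ρ x < k + 1 → ρ x < k := fun x hx =>
        lt_of_le_of_ne (Nat.lt_succ_iff.mp hx) (fun h => hv ⟨x, h⟩)
      obtain ⟨U, d, h⟩ := ih C fun z hz =>
        ⟨hlt _ (hC z hz).1, hlt _ (hC z hz).2.1, (hC z hz).2.2⟩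
      exact ⟨U, d, h.le, fun p x hp => (h.rank_lt p x hp).trans (Nat.lt_succ_self k),
        fun x hx => h.spanning x (hlt x hx), h.labeling, h.separates, h.encard_le⟩
    obtain ⟨v, hvk⟩ := hv
    have hlt : ∀ x, ρ x < k + 1 → x ≠ v → ρ x < k := fun x hx hne =>
      lt_of_le_of_ne (Nat.lt_succ_iff.mp hx) (fun h => hne (hinj (h.trans hvk.symm)))
    -- The partners of `v` in `C`.
    let N : α → Prop := fun x => (v, x) ∈ C ∨ (x, v) ∈ C
    have hN : ∀ x, N x → ρ x < k ∧ c x ≠ c v := by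
      rintro x (hx | hx)
      · have h := hC _ hx
        exact ⟨hlt x h.2.1 fun e => h.2.2 (by simp [e]), h.2.2.symm⟩
      · have h := hC _ hx
        exact ⟨hlt x h.1 fun e => h.2.2 (by simp [e]), h.2.2⟩
    let C₀ := C.filter fun z => z.1 ≠ v ∧ z.2 ≠ v
    have hC₀ : ∀ z ∈ C₀, ρ z.1 < k ∧ ρ z.2 < k ∧ c z.1 ≠ c z.2 := by
      intro z hz
      obtain ⟨hz, h1, h2⟩ := Finset.mem_filter.mp hz
      exact ⟨hlt _ (hC z hz).1 h1, hlt _ (hC z hz).2.1 h2, (hC z hz).2.2⟩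
    -- A pair of `C` lies in `C₀` or consists of `v` and a partner of `v`.
    have hcases : ∀ d : α → α, (∀ z ∈ C₀, d z.1 ≠ d z.2) → (∀ x, N x → d x ≠ d v) →
        ∀ z ∈ C, d z.1 ≠ d z.2 := by
      rintro d h0 h1 ⟨x, y⟩ hz
      by_cases hx : x = v
      · subst hx; exact (h1 y (Or.inl hz)).symm
      · by_cases hy : y = v
        · subst hy; exact h1 x (Or.inr hz)
        · exact h0 _ (Finset.mem_filter.mpr ⟨hz, hx, hy⟩)
    have hpk : ∀ p, D p v → ρ p < k := fun p hp => hvk ▸ hρ p v hp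
    -- Facts on a sparsification below rank `k`, in which `v` is isolated.
    have hiso : ∀ {C' U d}, IsSparsification D ρ k C' U d →
        (∀ p, ¬ U p v) ∧ (∀ x, ¬ U v x) ∧ ∀ x, ρ x < k → d x ≠ d v := by
      intro C' U d h
      have h1 : ∀ p, ¬ U p v := fun p hp => by have := h.rank_lt p v hp; omega
      refine ⟨h1, fun x hx => ?_, fun x hx e => ?_⟩
      · have := h.rank_lt v x hx; have := hρ v x (h.le v x hx); omega
      · have h2 := h.labeling.rank_le (fun p x hp => hρ p x (h.le p x hp)) x
        rw [e, h.labeling.eq_self h1] at h2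
        omega
    by_cases hpred : ∃ p, D p v
    swap
    · obtain ⟨U, d, h⟩ := ih C₀ hC₀
      refine ⟨U, d, h.le, fun p x hp => (h.rank_lt p x hp).trans (Nat.lt_succ_self k),
        fun x hx hp => h.spanning x (hlt x hx fun e => hpred (e ▸ hp)) hp, h.labeling,
        hcases d h.separates fun x hx => (hiso h).2.2 x (hN x hx).1, h.encard_le.trans ?_⟩
      have : C₀.card ≤ C.card := Finset.card_filter_le _ _
      exact_mod_cast Nat.sub_le_sub_right this 1
    by_cases hgood : ∃ p, D p v ∧ ∀ x, N x → c x ≠ c p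
    · obtain ⟨p, hp, hgood⟩ := hgood
      let φ : α → α := fun x => if x = v then p else x
      have hφv : φ v = p := if_pos rfl
      have hφ : ∀ x, x ≠ v → φ x = x := fun x hx => if_neg hx
      obtain ⟨U, d, h⟩ := ih (C.image fun z => (φ z.1, φ z.2)) (by
        intro z hz
        obtain ⟨⟨x, y⟩, hxy, rfl⟩ := Finset.mem_image.mp hz
        by_cases hx : x = v
        · subst hx
          have hy := hN y (Or.inl hxy)
          have hyx : y ≠ x := fun e => hy.2 (by rw [e])
          simp only [hφv, hφ y hyx]
          exact ⟨hpk p hp, hy.1, (hgood y (Or.inl hxy)).symm⟩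
        · by_cases hy : y = v
          · subst hy
            simp only [hφv, hφ x hx]
            exact ⟨(hN x (Or.inr hxy)).1, hpk p hp, hgood x (Or.inr hxy)⟩
          · simp only [hφ x hx, hφ y hy]
            exact hC₀ _ (Finset.mem_filter.mpr ⟨hxy, hx, hy⟩))
      obtain ⟨hi1, hi2, -⟩ := hiso h
      have hpv : p ≠ v := fun e => by have := hpk p hp; rw [e] at this; omega
      have hupd : ∀ x, Function.update d v (d p) x = d (φ x) := by
        intro x
        by_cases hx : x = v
        · subst hx; simp [hφv]
        · simp [hφ x hx, hx]
      refine ⟨addPreds U v {p}, Function.update d v (d p), ?_, ?_, ?_,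
        h.labeling.addPreds_singleton hi1 hi2 hpv, ?_, ?_⟩
      · rintro q x (hq | ⟨rfl, rfl⟩)
        · exact h.le q x hq
        · exact hp
      · rintro q x (hq | ⟨rfl, rfl⟩)
        · exact (h.rank_lt q x hq).trans (Nat.lt_succ_self k)
        · omega
      · intro x hx hxp
        by_cases hxv : x = v
        · exact ⟨p, Or.inr ⟨hxv, rfl⟩⟩
        · obtain ⟨q, hq⟩ := h.spanning x (hlt x hx hxv) hxp
          exact ⟨q, Or.inl hq⟩
      · intro z hz
        rw [hupd, hupd]
        exact h.separates _ (Finset.mem_image_of_mem (fun z : α × α => (φ z.1, φ z.2)) hz)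
      · have hsub : mergePoints (addPreds U v {p}) ⊆ mergePoints U := by
          rintro x ⟨q, r, hqr, hq, hr⟩
          by_cases hx : x = v
          · subst hx
            rw [addPreds_self hi1] at hq hr
            exact absurd (hq.trans hr.symm) hqr
          · rw [addPreds_of_ne hx] at hq hr
            exact ⟨q, r, hqr, hq, hr⟩
        refine (Set.encard_le_encard hsub).trans (h.encard_le.trans ?_)
        exact_mod_cast Nat.sub_le_sub_right Finset.card_image_le 1
    · push Not at hgood
      obtain ⟨p, q, hp, hq, hpq⟩ : ∃ p q, D p v ∧ D q v ∧ c p ≠ c q := by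
        rcases hc v with ⟨-, h0 | h0⟩ | ⟨⟨p, hp⟩, h1⟩
        · exact absurd hpred (not_exists.mpr h0)
        · exact h0
        · obtain ⟨x, hx, e⟩ := hgood p hp
          exact absurd (e.trans (h1 p hp)) (hN x hx).2
      have hcard : C₀.card + 2 ≤ C.card := by
        obtain ⟨x, hx, ex⟩ := hgood p hp
        obtain ⟨y, hy, ey⟩ := hgood q hq
        have hxy : x ≠ y := fun e => hpq (by rw [← ex, ← ey, e])
        have hpair : ∀ x, N x → ∃ z ∈ C, (z = (v, x) ∨ z = (x, v)) := by
          rintro x (hx | hx)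
          · exact ⟨_, hx, Or.inl rfl⟩
          · exact ⟨_, hx, Or.inr rfl⟩
        obtain ⟨z, hz, hzx⟩ := hpair x hx
        obtain ⟨w, hw, hwy⟩ := hpair y hy
        have hzw : z ≠ w := by
          have h1 : x ≠ v := fun e => (hN x hx).2 (by rw [e])
          rcases hzx with rfl | rfl <;> rcases hwy with rfl | rfl <;> simp <;> grind
        have hz0 : z ∉ C₀ := by
          rcases hzx with rfl | rfl <;> simp [C₀]
        have hw0 : w ∉ C₀ := by
          rcases hwy with rfl | rfl <;> simp [C₀]
        have hsub : insert z (insert w C₀) ⊆ C := by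
          intro t ht
          rcases Finset.mem_insert.mp ht with rfl | ht
          · exact hz
          · rcases Finset.mem_insert.mp ht with rfl | ht
            · exact hw
            · exact (Finset.mem_filter.mp ht).1
        have := Finset.card_le_card hsub
        rwa [Finset.card_insert_of_notMem (by simp [hzw, hz0]),
          Finset.card_insert_of_notMem hw0] at this
      obtain ⟨U, d, h⟩ := ih (insert (p, q) C₀) (by
        intro z hz
        rcases Finset.mem_insert.mp hz with rfl | hz
        · exact ⟨hpk p hp, hpk q hq, hpq⟩
        · exact hC₀ z hz)
      obtain ⟨hi1, -, hi3⟩ := hiso h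
      refine ⟨addPreds U v {p, q}, d, ?_, ?_, ?_,
        h.labeling.addPreds_pair hi1 (h.separates (p, q) (Finset.mem_insert_self _ _)), ?_, ?_⟩
      · rintro r x (hr | ⟨rfl, rfl | rfl⟩)
        · exact h.le r x hr
        · exact hp
        · exact hq
      · rintro r x (hr | ⟨rfl, -⟩)
        · exact (h.rank_lt r x hr).trans (Nat.lt_succ_self k)
        · omega
      · intro x hx hxp
        by_cases hxv : x = v
        · exact ⟨p, Or.inr ⟨hxv, Or.inl rfl⟩⟩
        · obtain ⟨r, hr⟩ := h.spanning x (hlt x hx hxv) hxp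
          exact ⟨r, Or.inl hr⟩
      · exact hcases d (fun z hz => h.separates z (Finset.mem_insert_of_mem hz))
          fun x hx => hi3 x (hN x hx).1
      · have hsub : mergePoints (addPreds U v {p, q}) ⊆ insert v (mergePoints U) := by
          rintro x ⟨r, s, hrs, hr, hs⟩
          by_cases hx : x = v
          · exact Or.inl hx
          · rw [addPreds_of_ne hx] at hr hs
            exact Or.inr ⟨r, s, hrs, hr, hs⟩
        refine (Set.encard_le_encard hsub).trans ((Set.encard_insert_le _ _).trans ?_)
        refine (add_le_add_left h.encard_le 1).trans ?_
        have h1 : (insert (p, q) C₀).card ≤ C₀.card + 1 := Finset.card_insert_le _ _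
        have : (insert (p, q) C₀).card - 1 + 1 ≤ C.card - 1 := by omega
        exact_mod_cast this

/-! ### Paths in directed graphs and the upper bound -/

namespace FinDirGraph

theorem isPath_append (G : FinDirGraph) {u v : G.V} {l m : List G.E} :
    G.IsPath u (l ++ m) v ↔ ∃ w, G.IsPath u l w ∧ G.IsPath w m v := by
  induction l generalizing u with
  | nil => simp [IsPath]
  | cons e l ih => simp [IsPath, ih, and_assoc]

theorem isPath_concat (G : FinDirGraph) {u v : G.V} {l : List G.E} {e : G.E} :
    G.IsPath u (l ++ [e]) v ↔ G.IsPath u l (G.src e) ∧ G.tgt e = v := by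
  rw [isPath_append]
  simp only [IsPath]
  constructor
  · rintro ⟨w, h, rfl, h'⟩; exact ⟨h, h'⟩
  · rintro ⟨h, h'⟩; exact ⟨_, h, rfl, h'⟩

/-- `G.Precedes s f e`: the edge `f` can be followed by `e` on a path starting at `s`. -/
def Precedes (G : FinDirGraph) (s : G.V) (f e : G.E) : Prop :=
  (∃ l, G.IsPath s l (G.src f)) ∧ G.tgt f = G.src e

/-- An acyclic graph admits an injective numbering of its edges that increases along paths: the
number of edges upstream, with ties broken by an arbitrary enumeration. -/
theorem Acyclic.exists_rank {G : FinDirGraph} (hG : G.Acyclic) :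
    ∃ ρ : G.E → ℕ, Function.Injective ρ ∧ ∀ f e, G.tgt f = G.src e → ρ f < ρ e := by
  have := G.finiteE
  let A : G.E → Set G.E := fun e => {f | ∃ l, G.IsPath (G.tgt f) l (G.src e)}
  have hA : ∀ f e, G.tgt f = G.src e → (A f).ncard < (A e).ncard := by
    intro f e hfe
    refine Set.ncard_lt_ncard ⟨?_, fun h => ?_⟩ (Set.toFinite _)
    · rintro g ⟨l, hl⟩
      exact ⟨l ++ [f], G.isPath_concat.2 ⟨hl, hfe⟩⟩
    · obtain ⟨l, hl⟩ := h (show f ∈ A e from ⟨[], hfe⟩)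
      have := hG _ _ (G.isPath_concat.2 ⟨hl, rfl⟩)
      simp at this
  let φ := Finite.equivFin G.E
  refine ⟨fun e => (φ e : ℕ) + Nat.card G.E * (A e).ncard, fun f e h => ?_, fun f e h => ?_⟩
  · have h' := congrArg (· % Nat.card G.E) h
    simp only [Nat.add_mul_mod_self_left, Nat.mod_eq_of_lt (φ _).2] at h'
    exact φ.injective (Fin.ext h')
  · have h1 := hA f e h
    have h2 := (φ f).2
    have h3 := Nat.mul_le_mul_left (Nat.card G.E) (Nat.succ_le_of_lt h1)
    rw [Nat.succ_eq_add_one, mul_add] at h3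
    show (φ f : ℕ) + _ < (φ e : ℕ) + _
    omega

theorem IsEdgeDisjointPaths.card_le {G : FinDirGraph} {u v : G.V} {P : Finset (List G.E)}
    {C : Finset G.E} (hP : G.IsEdgeDisjointPaths u v P) (hC : G.IsCut u v C) :
    P.card ≤ C.card := by
  have h : ∀ p : P, ∃ e ∈ p.1, e ∈ C := fun p => hC p (hP.1 p p.2)
  choose f hf hfC using h
  rw [← Fintype.card_coe P, ← Fintype.card_coe C]
  refine Fintype.card_le_of_injective (fun p => ⟨f p, hfC p⟩) fun p q hpq => ?_
  have e : f p = f q := congrArg Subtype.val hpq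
  by_contra hne
  exact hP.2 p p.2 q q.2 (fun h => hne (Subtype.ext h)) _ (hf p) (e ▸ hf q)

theorem exists_isCut_of_minCut_eq {G : FinDirGraph} {u v : G.V} {k : ℕ}
    (h : G.minCut u v = k) : ∃ C, G.IsCut u v C ∧ C.card ≤ k := by
  have h1 : G.minCut u v < ((k + 1 : ℕ) : ℕ∞) := by
    rw [h]; exact_mod_cast Nat.lt_succ_self k
  simp only [minCut, iInf_lt_iff] at h1
  obtain ⟨C, hC, hlt⟩ := h1
  exact ⟨C, hC, Nat.lt_succ_iff.mp (by exact_mod_cast hlt)⟩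

theorem le_card_of_minCut_eq {G : FinDirGraph} {u v : G.V} {k : ℕ}
    (h : G.minCut u v = k) {C : Finset G.E} (hC : G.IsCut u v C) : k ≤ C.card := by
  have h1 : G.minCut u v ≤ C.card := iInf₂_le C hC
  rw [h] at h1
  exact_mod_cast h1

theorem pair_isEdgeDisjointPaths {G : FinDirGraph} [DecidableEq (List G.E)] {u v : G.V}
    {l m : List G.E} (hl : G.IsPath u l v) (hm : G.IsPath u m v) (h : ∀ e ∈ l, e ∉ m) :
    G.IsEdgeDisjointPaths u v {l, m} := by
  refine ⟨fun p hp => ?_, fun p hp q hq hpq e hep heq => ?_⟩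
  · rcases Finset.mem_insert.mp hp with rfl | hp
    · exact hl
    · rwa [Finset.mem_singleton.mp hp]
  · simp only [Finset.mem_insert, Finset.mem_singleton] at hp hq
    rcases hp with rfl | rfl <;> rcases hq with rfl | rfl
    · exact hpq rfl
    · exact h e hep heq
    · exact h e heq hep
    · exact hpq rfl

theorem Acyclic.sourcePath_of_isPath {G : FinDirGraph} (hG : G.Acyclic) {s v : G.V}
    {l : List G.E} {e : G.E} (h : G.IsPath s (l ++ [e]) v) :
    SourcePath (G.Precedes s) (l ++ [e]) e := by
  induction l using List.reverseRecOn generalizing e v with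
  | nil =>
    refine .source ?_
    rintro p ⟨⟨l, hl⟩, hp⟩
    have hs : G.src e = s := h.1
    have := hG s (l ++ [p]) (G.isPath_concat.2 ⟨hl, hp.trans hs⟩)
    simp at this
  | append_singleton l f ih =>
    obtain ⟨h1, -⟩ := G.isPath_concat.1 h
    exact (ih h1).step ⟨⟨l, (G.isPath_concat.1 h1).1⟩, (G.isPath_concat.1 h1).2⟩

/-- Chains of a spanning subrelation of `G.Precedes s` are paths from `s`. -/
theorem isPath_of_sourcePath {G : FinDirGraph} {s : G.V} {U : G.E → G.E → Prop}
    (hle : ∀ p x, U p x → G.Precedes s p x)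
    (hsp : ∀ x, (∃ p, G.Precedes s p x) → ∃ p, U p x) {l : List G.E} {x : G.E}
    (h : SourcePath U l x) (hx : ∃ l, G.IsPath s l (G.src x)) : G.IsPath s l (G.tgt x) := by
  induction h with
  | @source x h0 =>
    obtain ⟨l, hl⟩ := hx
    rcases List.eq_nil_or_concat l with rfl | ⟨l, f, rfl⟩
    · exact ⟨hl.symm, rfl⟩
    · rw [List.concat_eq_append, isPath_concat] at hl
      obtain ⟨p, hp⟩ := hsp x ⟨f, ⟨l, hl.1⟩, hl.2⟩
      exact absurd hp (h0 p)
  | @step l p x _ hp ih =>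
    have h := hle p x hp
    exact G.isPath_concat.2 ⟨h.2 ▸ ih h.1, rfl⟩

/-- If the min-cut is two, two edges entering `v` carry different labels, since a common label
would be a cut. -/
theorem exists_labels_ne {G : FinDirGraph} (hG : G.Acyclic) {s v : G.V} (hv : G.minCut s v = (2 : ℕ))
    {c : G.E → G.E} (hc : IsLabeling (G.Precedes s) c) :
    ∃ x y, (∃ l, G.IsPath s l (G.src x)) ∧ (∃ l, G.IsPath s l (G.src y)) ∧
      G.tgt x = v ∧ G.tgt y = v ∧ c x ≠ c y := by
  by_contra! hcon
  obtain ⟨C₀, hC₀, -⟩ := exists_isCut_of_minCut_eq hv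
  have hlast : ∀ l, G.IsPath s l v → ∃ e, (∃ l, G.IsPath s l (G.src e)) ∧ G.tgt e = v ∧ c e ∈ l := by
    intro l hl
    rcases List.eq_nil_or_concat l with rfl | ⟨l, e, rfl⟩
    · obtain ⟨e, he, -⟩ := hC₀ [] hl
      simp at he
    · rw [List.concat_eq_append] at hl ⊢
      have h := G.isPath_concat.1 hl
      exact ⟨e, ⟨l, h.1⟩, h.2, hc.mem_of_sourcePath (hG.sourcePath_of_isPath hl)⟩
  by_cases hx : ∃ x, (∃ l, G.IsPath s l (G.src x)) ∧ G.tgt x = v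
  · obtain ⟨x, hx, hxv⟩ := hx
    have hcut : G.IsCut s v {c x} := by
      intro l hl
      obtain ⟨e, he, hev, hel⟩ := hlast l hl
      exact ⟨c e, hel, Finset.mem_singleton.mpr (hcon x e hx he hxv hev).symm⟩
    have := le_card_of_minCut_eq hv hcut
    simp at this
  · have hcut : G.IsCut s v ∅ := by
      intro l hl
      obtain ⟨e, he, hev, -⟩ := hlast l hl
      exact absurd ⟨e, he, hev⟩ hx
    have := le_card_of_minCut_eq hv hcut
    simp at this

end FinDirGraph

theorem OneSourceNetwork.minMergings_le {n : ℕ} (N : OneSourceNetwork fun _ : Fin n => 2) :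
    N.minMergings ≤ ((n - 1 : ℕ) : ℕ∞) := by
  classical
  have := N.G.finiteE
  obtain ⟨ρ, hinj, hρ⟩ := N.acyclic.exists_rank
  have hρ' : ∀ p x, N.G.Precedes N.source p x → ρ p < ρ x := fun p x h => hρ p x h.2
  obtain ⟨c, hc⟩ := exists_isLabeling hρ'
  choose x y hx hy hxt hyt hxy using
    fun i => FinDirGraph.exists_labels_ne N.acyclic (N.minCut_eq i) hc
  obtain ⟨k, hk⟩ := (Set.finite_range ρ).bddAbove
  have hk : ∀ e, ρ e < k + 1 := fun e => Nat.lt_succ_of_le (hk ⟨e, rfl⟩)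
  obtain ⟨U, d, h⟩ := hc.exists_isSparsification hρ' hinj (k + 1)
    (Finset.univ.image fun i => (x i, y i)) (by
      intro z hz
      obtain ⟨i, -, rfl⟩ := Finset.mem_image.mp hz
      exact ⟨hk _, hk _, hxy i⟩)
  choose l m hl hm hlm using fun i => h.labeling.exists_disjoint
    (fun p x hp => hρ' p x (h.le p x hp)) hinj (x i) (y i)
    (h.separates (x i, y i) (Finset.mem_image_of_mem (fun i => (x i, y i)) (Finset.mem_univ i)))
  have hlp : ∀ i, N.G.IsPath N.source (l i) (N.sink i) := fun i => hxt i ▸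
    FinDirGraph.isPath_of_sourcePath h.le (fun x => h.spanning x (hk x)) (hl i) (hx i)
  have hmp : ∀ i, N.G.IsPath N.source (m i) (N.sink i) := fun i => hyt i ▸
    FinDirGraph.isPath_of_sourcePath h.le (fun x => h.spanning x (hk x)) (hm i) (hy i)
  have hne : ∀ i, l i ≠ m i := fun i e =>
    hlm i (x i) (List.mem_of_getLast? (hl i).getLast?) (e ▸ List.mem_of_getLast? (hl i).getLast?)
  have hmenger : ∀ i, N.G.IsMengerPaths N.source (N.sink i) {l i, m i} := by
    intro i
    refine ⟨FinDirGraph.pair_isEdgeDisjointPaths (hlp i) (hmp i) (hlm i), fun Q hQ => ?_⟩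
    obtain ⟨C, hC, hC2⟩ := FinDirGraph.exists_isCut_of_minCut_eq (N.minCut_eq i)
    rw [Finset.card_pair (hne i)]
    exact (hQ.card_le hC).trans hC2
  refine (iInf₂_le (fun i => {l i, m i}) hmenger).trans ?_
  have hchain : ∀ p ∈ (⋃ i, ((({l i, m i} : Finset (List N.G.E))) : Set (List N.G.E))),
      p.IsChain U := by
    intro p hp
    obtain ⟨i, hi⟩ := Set.mem_iUnion.mp hp
    rcases Finset.mem_insert.mp (Finset.mem_coe.mp hi) with rfl | hi
    · exact (hl i).isChain
    · rw [Finset.mem_singleton.mp hi]; exact (hm i).isChain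
  have hsub : N.G.mergings (⋃ i, ((({l i, m i} : Finset (List N.G.E))) : Set (List N.G.E))) ⊆
      mergePoints U := by
    rintro e ⟨B, hB, -, β, hβ, γ, hγ, -, f, g, hfg, hf, hg⟩
    refine ⟨f, g, hfg, ?_, ?_⟩
    · simpa using (hchain β (hB hβ)).infix hf
    · simpa using (hchain γ (hB hγ)).infix hg
  refine (Set.encard_le_encard hsub).trans (h.encard_le.trans ?_)
  have : (Finset.univ.image fun i => (x i, y i)).card ≤ n := by
    simpa using Finset.card_image_le (s := Finset.univ) (f := fun i => (x i, y i))
  exact_mod_cast Nat.sub_le_sub_right this 1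

/-! ### The chain network and the lower bound -/

/-- The vertices of the chain network: the source, a hub, the heads `w i` and the tails `u j` of
the chain edges, and the sinks `r i`. -/
inductive ChainVertex (t : ℕ) : Type
  | source : ChainVertex t
  | hub : ChainVertex t
  | w : Fin (t + 1) → ChainVertex t
  | u : Fin t → ChainVertex t
  | r : Fin (t + 1) → ChainVertex t

/-- The edges of the chain network. The edges `m j` form a chain starting with `a`; each `m j` is
fed by its predecessor in the chain through `p j` and by `b` through `q j`. The sink `r i` listens
to the `i`-th member of the chain through `x i` and to the next one through `y i`, the successor of
the last member being `b`, heard through `z`. -/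
inductive ChainEdge (t : ℕ) : Type
  | a : ChainEdge t
  | b : ChainEdge t
  | p : Fin t → ChainEdge t
  | q : Fin t → ChainEdge t
  | m : Fin t → ChainEdge t
  | x : Fin (t + 1) → ChainEdge t
  | y : Fin t → ChainEdge t
  | z : ChainEdge t

theorem ChainVertex.finite (t : ℕ) : Finite (ChainVertex t) := by
  let f : Bool ⊕ Fin (t + 1) ⊕ Fin t ⊕ Fin (t + 1) → ChainVertex t
    | .inl false => .source
    | .inl true => .hub
    | .inr (.inl i) => .w i
    | .inr (.inr (.inl j)) => .u j
    | .inr (.inr (.inr i)) => .r i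
  refine Finite.of_surjective f ?_
  rintro (_ | _ | i | j | i)
  · exact ⟨.inl false, rfl⟩
  · exact ⟨.inl true, rfl⟩
  · exact ⟨.inr (.inl i), rfl⟩
  · exact ⟨.inr (.inr (.inl j)), rfl⟩
  · exact ⟨.inr (.inr (.inr i)), rfl⟩

theorem ChainEdge.finite (t : ℕ) : Finite (ChainEdge t) := by
  let f : Fin 3 ⊕ (Fin 4 × Fin t) ⊕ Fin (t + 1) → ChainEdge t
    | .inl 0 => .a
    | .inl 1 => .b
    | .inl 2 => .z
    | .inr (.inl (0, j)) => .p j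
    | .inr (.inl (1, j)) => .q j
    | .inr (.inl (2, j)) => .m j
    | .inr (.inl (3, j)) => .y j
    | .inr (.inr i) => .x i
  refine Finite.of_surjective f ?_
  rintro (_ | _ | j | j | j | i | j | _)
  · exact ⟨.inl 0, rfl⟩
  · exact ⟨.inl 1, rfl⟩
  · exact ⟨.inr (.inl (0, j)), rfl⟩
  · exact ⟨.inr (.inl (1, j)), rfl⟩
  · exact ⟨.inr (.inl (2, j)), rfl⟩
  · exact ⟨.inr (.inr i), rfl⟩
  · exact ⟨.inr (.inl (3, j)), rfl⟩
  · exact ⟨.inl 2, rfl⟩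

/-- The underlying graph of the chain network. -/
abbrev chainGraph (t : ℕ) : FinDirGraph where
  V := ChainVertex t
  E := ChainEdge t
  finiteV := ChainVertex.finite t
  finiteE := ChainEdge.finite t
  src
    | .a => .source
    | .b => .source
    | .p j => .w j.castSucc
    | .q _ => .hub
    | .m j => .u j
    | .x i => .w i
    | .y j => .w j.succ
    | .z => .hub
  tgt
    | .a => .w 0
    | .b => .hub
    | .p j => .u j
    | .q j => .u j
    | .m j => .w j.succ
    | .x i => .r i
    | .y j => .r j.castSucc
    | .z => .r (Fin.last t)

/-- A height function on the vertices of the chain network that increases along edges. -/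
def ChainVertex.height {t : ℕ} : ChainVertex t → ℕ
  | .source => 0
  | .hub => 1
  | .w i => 2 * i + 2
  | .u j => 2 * j + 3
  | .r _ => 2 * t + 3

theorem FinDirGraph.acyclic_of_height {G : FinDirGraph} (f : G.V → ℕ)
    (hf : ∀ e, f (G.src e) < f (G.tgt e)) : G.Acyclic := by
  have key : ∀ (l : List G.E) (u v : G.V), G.IsPath u l v → f u + l.length ≤ f v := by
    intro l
    induction l with
    | nil => rintro u v rfl; simp
    | cons e l ih =>
      rintro u v ⟨rfl, h⟩
      have h1 := ih _ _ h
      have h2 := hf e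
      simp only [List.length_cons]
      omega
  intro v l h
  have := key l v v h
  exact List.length_eq_zero_iff.mp (by omega)

theorem chainGraph_acyclic (t : ℕ) : (chainGraph t).Acyclic := by
  refine FinDirGraph.acyclic_of_height ChainVertex.height ?_
  rintro (_ | _ | j | j | j | i | j | _) <;> simp [ChainVertex.height] <;> omega

/-- A path between distinct vertices has a last edge. -/
theorem FinDirGraph.IsPath.exists_concat {G : FinDirGraph} {u v : G.V} {l : List G.E}
    (h : G.IsPath u l v) (huv : u ≠ v) :
    ∃ l' e, l = l' ++ [e] ∧ G.IsPath u l' (G.src e) ∧ G.tgt e = v := by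
  rcases List.eq_nil_or_concat l with rfl | ⟨l, e, rfl⟩
  · exact absurd h huv
  · rw [List.concat_eq_append] at h ⊢
    exact ⟨l, e, rfl, G.isPath_concat.1 h⟩

section

variable {t : ℕ}

theorem chainGraph_path_hub {l : List (ChainEdge t)}
    (h : (chainGraph t).IsPath ChainVertex.source l ChainVertex.hub) : ChainEdge.b ∈ l := by
  obtain ⟨l, e, rfl, -, he⟩ := h.exists_concat (by simp)
  have : e = ChainEdge.b := by cases e <;> simp [chainGraph] at he ⊢
  simp [this]

theorem chainGraph_path_w_zero {l : List (ChainEdge t)}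
    (h : (chainGraph t).IsPath ChainVertex.source l (ChainVertex.w 0)) : ChainEdge.a ∈ l := by
  obtain ⟨l, e, rfl, -, he⟩ := h.exists_concat (by simp)
  have : e = ChainEdge.a := by cases e <;> simp [chainGraph] at he ⊢
  simp [this]

/-- A path to the head of a chain edge arrives along the chain or from the hub. -/
theorem chainGraph_path_w_succ {l : List (ChainEdge t)} {j : Fin t}
    (h : (chainGraph t).IsPath ChainVertex.source l (ChainVertex.w j.succ)) :
    ∃ l', (l = l' ++ [.p j, .m j] ∧
        (chainGraph t).IsPath ChainVertex.source l' (ChainVertex.w j.castSucc)) ∨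
      (l = l' ++ [.q j, .m j] ∧ (chainGraph t).IsPath ChainVertex.source l' ChainVertex.hub) := by
  obtain ⟨l, e, rfl, hl, he⟩ := h.exists_concat (by simp)
  have : e = ChainEdge.m j := by
    cases e <;> simp [chainGraph] at he ⊢
    · exact absurd he.symm (Fin.succ_ne_zero j)
    · exact he
  subst this
  obtain ⟨l, f, rfl, hl, hf⟩ := hl.exists_concat (by simp [chainGraph])
  have : f = ChainEdge.p j ∨ f = ChainEdge.q j := by
    cases f <;> simp [chainGraph] at hf ⊢ <;> exact hf
  rcases this with rfl | rfl
  · exact ⟨l, Or.inl ⟨by simp, hl⟩⟩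
  · exact ⟨l, Or.inr ⟨by simp, hl⟩⟩

/-- A path into the chain that avoids `b` runs along the whole chain. -/
theorem chainGraph_path_w_avoiding (i : Fin (t + 1)) : ∀ l : List (ChainEdge t),
    (chainGraph t).IsPath ChainVertex.source l (ChainVertex.w i) → ChainEdge.b ∉ l →
    ∀ j : Fin t, j.castSucc < i → [ChainEdge.p j, ChainEdge.m j] <:+: l := by
  induction i using Fin.induction with
  | zero => intro l _ _ j hj; exact absurd hj (Fin.not_lt_zero _)
  | succ i ih =>
    intro l hl hb j hj
    obtain ⟨l, ⟨rfl, hl'⟩ | ⟨rfl, hl'⟩⟩ := chainGraph_path_w_succ hl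
    · rcases eq_or_lt_of_le (Fin.castSucc_lt_succ_iff.mp hj) with rfl | hji
      · exact (List.suffix_append _ _).isInfix
      · exact (ih l hl' (fun h => hb (List.mem_append_left _ h)) j hji).trans
          (List.prefix_append _ _).isInfix
    · exact absurd (List.mem_append_left _ (chainGraph_path_hub hl')) hb

/-- All paths to `w i` share their last edge. -/
theorem chainGraph_paths_w_meet {i : Fin (t + 1)} {l m : List (ChainEdge t)}
    (hl : (chainGraph t).IsPath ChainVertex.source l (ChainVertex.w i))
    (hm : (chainGraph t).IsPath ChainVertex.source m (ChainVertex.w i)) : ∃ e ∈ l, e ∈ m := by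
  induction i using Fin.cases with
  | zero => exact ⟨_, chainGraph_path_w_zero hl, chainGraph_path_w_zero hm⟩
  | succ j =>
    refine ⟨ChainEdge.m j, ?_, ?_⟩
    · obtain ⟨l, ⟨rfl, -⟩ | ⟨rfl, -⟩⟩ := chainGraph_path_w_succ hl <;> simp
    · obtain ⟨l, ⟨rfl, -⟩ | ⟨rfl, -⟩⟩ := chainGraph_path_w_succ hm <;> simp

/-- Two disjoint paths to a sink use its two incoming edges, of which the first comes from `w i`. -/
theorem chainGraph_disjoint_paths {i : Fin (t + 1)} {l m : List (ChainEdge t)}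
    (hl : (chainGraph t).IsPath ChainVertex.source l (ChainVertex.r i))
    (hm : (chainGraph t).IsPath ChainVertex.source m (ChainVertex.r i)) (hlm : ∀ e ∈ l, e ∉ m) :
    ∃ l₁ l₂ e, ((l = l₁ ++ [.x i] ∧ m = l₂ ++ [e]) ∨ (m = l₁ ++ [.x i] ∧ l = l₂ ++ [e])) ∧
      (chainGraph t).IsPath ChainVertex.source l₁ (ChainVertex.w i) ∧
      (chainGraph t).IsPath ChainVertex.source l₂ ((chainGraph t).src e) ∧
      (chainGraph t).tgt e = ChainVertex.r i ∧ e ≠ .x i := by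
  obtain ⟨l, e, rfl, hl, he⟩ := hl.exists_concat (by simp)
  obtain ⟨m, f, rfl, hm, hf⟩ := hm.exists_concat (by simp)
  have hef : e ≠ f := fun h => hlm e (by simp) (by simp [h])
  by_cases hx : e = ChainEdge.x i
  · subst hx
    exact ⟨l, m, f, Or.inl ⟨rfl, rfl⟩, hl, hm, hf, hef.symm⟩
  by_cases hx' : f = ChainEdge.x i
  · subst hx'
    exact ⟨m, l, e, Or.inr ⟨rfl, rfl⟩, hm, hl, he, hef⟩
  exfalso
  -- The sink has only one incoming edge besides `x i`.
  clear hl hm hlm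
  cases e <;> cases f <;> simp [chainGraph] at he hf hx hx' hef <;>
    grind [Fin.castSucc_inj, Fin.castSucc_ne_last]

theorem chainGraph_exists_chain_path (i : Fin (t + 1)) : ∃ l : List (ChainEdge t),
    (chainGraph t).IsPath ChainVertex.source l (ChainVertex.w i) ∧
      ∀ e ∈ l, e = .a ∨ ∃ j : Fin t, j.castSucc < i ∧ (e = .p j ∨ e = .m j) := by
  induction i using Fin.induction with
  | zero => exact ⟨[.a], ⟨rfl, rfl⟩, by simp⟩
  | succ i ih =>
    obtain ⟨l, hl, h⟩ := ih
    refine ⟨l ++ [.p i, .m i], ?_, fun e he => ?_⟩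
    · exact (chainGraph t).isPath_append.2 ⟨_, hl, rfl, rfl, rfl⟩
    · rcases List.mem_append.mp he with he | he
      · rcases h e he with rfl | ⟨j, hj, he⟩
        · exact Or.inl rfl
        · exact Or.inr ⟨j, hj.trans Fin.castSucc_lt_succ, he⟩
      · exact Or.inr ⟨i, Fin.castSucc_lt_succ, by simpa using he⟩

theorem chainGraph_exists_disjoint (i : Fin (t + 1)) : ∃ l m : List (ChainEdge t),
    (chainGraph t).IsPath ChainVertex.source l (ChainVertex.r i) ∧
    (chainGraph t).IsPath ChainVertex.source m (ChainVertex.r i) ∧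
    l ≠ m ∧ ∀ e ∈ l, e ∉ m := by
  obtain ⟨l, hl, h⟩ := chainGraph_exists_chain_path i
  have hx : (chainGraph t).IsPath ChainVertex.source (l ++ [.x i]) (ChainVertex.r i) :=
    (chainGraph t).isPath_concat.2 ⟨hl, rfl⟩
  have key : ∃ m : List (ChainEdge t),
      (chainGraph t).IsPath ChainVertex.source m (ChainVertex.r i) ∧ ∀ e ∈ l ++ [.x i], e ∉ m := by
    induction i using Fin.lastCases with
    | last =>
      refine ⟨[.b, .z], ⟨rfl, rfl, rfl⟩, fun e he => ?_⟩
      rcases List.mem_append.mp he with he | he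
      · rcases h e he with rfl | ⟨j, -, rfl | rfl⟩ <;> simp
      · simp at he; simp [he]
    | cast j =>
      refine ⟨[.b, .q j, .m j, .y j], ⟨rfl, rfl, rfl, rfl, rfl⟩, fun e he => ?_⟩
      rcases List.mem_append.mp he with he | he
      · rcases h e he with rfl | ⟨k, hk, rfl | rfl⟩
        · simp
        · simp
        · have : k ≠ j := fun e => by simp [e] at hk
          simpa using this
      · simp at he; simp [he]
  obtain ⟨m, hm, hd⟩ := key
  exact ⟨_, m, hx, hm, fun e => hd (.x i) (by simp) (e ▸ by simp), hd⟩

theorem chainGraph_minCut (i : Fin (t + 1)) :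
    (chainGraph t).minCut ChainVertex.source (ChainVertex.r i) = ((2 : ℕ) : ℕ∞) := by
  classical
  refine le_antisymm ?_ (le_iInf₂ fun C hC => ?_)
  · have hcut : (chainGraph t).IsCut ChainVertex.source (ChainVertex.r i)
        ({.a, .b} : Finset (ChainEdge t)) := by
      rintro (_ | ⟨e, l⟩) h
      · exact absurd h (by simp [FinDirGraph.IsPath])
      · have he := h.1
        refine ⟨e, by simp, ?_⟩
        cases e <;> simp [chainGraph] at he ⊢
    refine (iInf₂_le _ hcut).trans ?_
    exact_mod_cast Finset.card_le_two
  · obtain ⟨l, m, hl, hm, hne, hd⟩ := chainGraph_exists_disjoint i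
    have := (FinDirGraph.pair_isEdgeDisjointPaths hl hm hd).card_le hC
    rw [Finset.card_pair hne] at this
    exact_mod_cast this

end

/-- The chain network with its sinks `r i`. -/
abbrev chainNetwork (t : ℕ) : OneSourceNetwork fun _ : Fin (t + 1) => 2 where
  G := chainGraph t
  acyclic := chainGraph_acyclic t
  source := ChainVertex.source
  sink := ChainVertex.r
  sink_injective := fun i j h => by simpa using h
  minCut_eq := chainGraph_minCut

/-- Every edge `m j` is forced to be a merging: the sink `r j` needs `q j` followed by `m j`, since
its path through `w j` blocks the chain, and the last sink needs the whole chain, since its other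
path blocks `b`. -/
theorem chainNetwork_minMergings (t : ℕ) : (t : ℕ∞) ≤ (chainNetwork t).minMergings := by
  classical
  refine le_iInf₂ fun α hα => ?_
  have hpair : ∀ i : Fin (t + 1), ∃ l₁ l₂ : List (ChainEdge t), ∃ e : ChainEdge t,
      l₁ ++ [.x i] ∈ α i ∧ l₂ ++ [e] ∈ α i ∧ (∀ e ∈ l₁, e ∉ l₂) ∧
      (chainGraph t).IsPath ChainVertex.source l₁ (ChainVertex.w i) ∧
      (chainGraph t).IsPath ChainVertex.source l₂ ((chainGraph t).src e) ∧
      (chainGraph t).tgt e = ChainVertex.r i ∧ e ≠ .x i := by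
    intro i
    obtain ⟨l, m, hl, hm, hne, hd⟩ := chainGraph_exists_disjoint i
    have hcard := (hα i).2 _ (FinDirGraph.pair_isEdgeDisjointPaths hl hm hd)
    rw [Finset.card_pair hne] at hcard
    obtain ⟨β, hβ, γ, hγ, hβγ⟩ := Finset.one_lt_card.mp hcard
    have hdisj := (hα i).1.2 β hβ γ hγ hβγ
    obtain ⟨l₁, l₂, e, ⟨rfl, rfl⟩ | ⟨rfl, rfl⟩, h1, h2, h3, h4⟩ :=
      chainGraph_disjoint_paths ((hα i).1.1 β hβ) ((hα i).1.1 γ hγ) hdisj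
    · exact ⟨l₁, l₂, e, hβ, hγ, fun f hf hf' => hdisj f (List.mem_append_left _ hf)
        (List.mem_append_left _ hf'), h1, h2, h3, h4⟩
    · exact ⟨l₁, l₂, e, hγ, hβ, fun f hf hf' => hdisj f (List.mem_append_left _ hf')
        (List.mem_append_left _ hf), h1, h2, h3, h4⟩
  have hp : ∃ β ∈ α (Fin.last t), ChainEdge.b ∉ β ∧
      ∀ j : Fin t, [ChainEdge.p j, ChainEdge.m j] <:+: β := by
    obtain ⟨l₁, l₂, e, h1, -, hd, hl₁, hl₂, he, hne⟩ := hpair (Fin.last t)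
    have : e = ChainEdge.z := by
      cases e <;> simp [chainGraph] at he hne ⊢
      · exact absurd he hne
    subst this
    have hb : ChainEdge.b ∉ l₁ := fun h => hd _ h (chainGraph_path_hub hl₂)
    refine ⟨_, h1, by simpa using hb, fun j => ?_⟩
    exact (chainGraph_path_w_avoiding _ l₁ hl₁ hb j
      (Fin.castSucc_lt_last j)).trans (List.prefix_append _ _).isInfix
  have hq : ∀ j : Fin t, ∃ γ ∈ α j.castSucc, ChainEdge.b ∈ γ ∧
      [ChainEdge.q j, ChainEdge.m j] <:+: γ := by
    intro j
    obtain ⟨l₁, l₂, e, -, h2, hd, hl₁, hl₂, he, hne⟩ := hpair j.castSucc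
    have : e = ChainEdge.y j := by
      cases e <;> simp [chainGraph] at he hne ⊢
      · exact absurd he hne
      · exact he
      · exact absurd he.symm (Fin.castSucc_ne_last _)
    subst this
    obtain ⟨l, ⟨rfl, hl⟩ | ⟨rfl, hl⟩⟩ := chainGraph_path_w_succ hl₂
    · obtain ⟨f, hf, hf'⟩ := chainGraph_paths_w_meet hl₁ hl
      exact absurd (List.mem_append_left _ hf') (hd f hf)
    · exact ⟨_, h2, by simp [chainGraph_path_hub hl],
        (List.suffix_append _ _).isInfix.trans (List.prefix_append _ _).isInfix⟩
  obtain ⟨β, hβ, hbβ, hp⟩ := hp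
  have hsub : Set.range (ChainEdge.m : Fin t → ChainEdge t) ⊆
      (chainGraph t).mergings (⋃ i, (α i : Set (List (ChainEdge t)))) := by
    rintro _ ⟨j, rfl⟩
    obtain ⟨γ, hγ, hbγ, hq⟩ := hq j
    have hne : β ≠ γ := fun h => hbβ (h ▸ hbγ)
    refine ⟨{β, γ}, ?_, ?_, β, by simp, γ, by simp, hne, .p j, .q j, by simp, hp j, hq⟩
    · rintro δ (rfl | rfl)
      · exact Set.mem_iUnion.mpr ⟨_, hβ⟩
      · exact Set.mem_iUnion.mpr ⟨_, hγ⟩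
    · rintro δ (rfl | rfl)
      · exact (hp j).subset (by simp)
      · exact hq.subset (by simp)
  refine le_trans ?_ (Set.encard_le_encard hsub)
  rw [← Set.image_univ, Function.Injective.encard_image (fun i j h => by simpa using h)]
  simp

/-! ### The extremal value -/

theorem MStar_two (n : ℕ) (hn : 1 ≤ n) :
    MStar (fun _ : Fin n => 2) = ((n - 1 : ℕ) : ℕ∞) := by
  obtain ⟨t, rfl⟩ : ∃ t, n = t + 1 := ⟨n - 1, by omega⟩
  refine le_antisymm (iSup_le fun N => N.minMergings_le) ?_
  exact (chainNetwork_minMergings t).trans (le_iSup OneSourceNetwork.minMergings (chainNetwork t))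

theorem mainTheorem7 :
    (∀ n : ℕ, 2 ≤ n →
      MStar (fun _ : Fin n => 2) = MStar (fun _ : Fin (n - 1) => 2) + 1) ∧
    (∀ n : ℕ, 1 ≤ n → MStar (fun _ : Fin n => 2) = ((n - 1 : ℕ) : ℕ∞)) := by
  refine ⟨fun n hn => ?_, MStar_two⟩
  rw [MStar_two n (by omega), MStar_two (n - 1) (by omega)]
  have : n - 1 = n - 1 - 1 + 1 := by omega
  exact_mod_cast this
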